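/- Let $G$ be a finite connected trivalent multigraph (loops and multiple edges allowed; a single vertex-less circle is also allowed). A ribbon graph $\Gamma$ of $G$ is a surface with boundary containing $G$ and deformation retracting onto it; it is given by a cyclic ordering of the half-edges at every vertex together with a sign for every edge (disks for vertices, bands for edges, and a half-twist in the band of each negative edge). It is oriented if the surface is orientable and has been given an orientation. Two ribbon graphs are equivalent if there is a homeomorphism of the associated closed surfaces (disks glued to all boundary circles) inducing an isomorphism of the embedded graphs. The vertex polynomial is $$V(\Gamma,n)=\sum_{\nu\subseteq V(G)}(-1)^{|\nu|}\,n^{k_\nu}\in\mathbb Z[n],$$ where $k_\nu$ is the number of circles in the vertex state $\nu$. This state is obtained from the boundary circles of $\Gamma$ by keeping the boundary arcs at each vertex outside $\nu$ ($0$-smoothing) and, at each vertex in $\nu$, reconnecting the ends of the two sides of each of the three bands as prescribed by the reversed cyclic order ($1$-smoothing). In other words, $V$ is computed by replacing each vertex by its $0$-smoothing minus its $1$-smoothing, with loop value $n$. For ribbon graphs $\Gamma_1,\Gamma_2$ of $G$, say that $\Gamma_1$ is even (respectively odd) with respect to $\Gamma_2$ if $\Gamma_1$ becomes equivalent to $\Gamma_2$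 after inserting an even (respectively odd) total number of half-twists into its bands. (A pair can be both even and odd if $G$ has nontrivial automorphisms.) **Lemma.** (1) For any two oriented ribbon graphs $\Gamma_1,\Gamma_2$ of $G$, $V(\Gamma_1,n)=\pm V(\Gamma_2,n)$ as polynomials in $n$. Moreover $\Gamma_1$ is even or odd with respect to $\Gamma_2$; if it is even, then $V(\Gamma_1,n)=V(\Gamma_2,n)$, and if it is odd, then $V(\Gamma_1,n)=-V(\Gamma_2,n)$. (2) Consequently the vertex polynomial is an abstract graph invariant. Call an oriented ribbon graph nonnegative if the leading coefficient of its vertex polynomial is nonnegative (the leading coefficient of the zero polynomial being $0$). Then $G$ has a nonnegative oriented ribbon graph, all nonnegative oriented ribbon graphs $\Gamma$ of $G$ have the same vertex polynomial $V(G,n):=V(\Gamma,n)$, and isomorphic connected trivalent graphs have the same polynomial $V(G,n)$. -/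

import Mathlib

open Polynomial

/-- A multigraph with vertex set `V`. Every edge in `E` is an interval, so it has two half-edges
`(e, false)` and `(e, true)`; `vert` says to which vertex each half-edge is attached. Loops and
multiple edges are allowed. `C` is the set of vertex-less edges (circles that meet no vertex). -/
structure MultiGraph (V E C : Type*) where
  /-- the vertex to which a half-edge is attached -/
  vert : E × Bool → V

namespace MultiGraph

variable {V E C V' E' C' : Type*}

/-- Every vertex is met by exactly three half-edges. -/
def Trivalent (G : MultiGraph V E C) : Prop :=
  ∀ v : V, {h : E × Bool | G.vert h = v}.ncard = 3

/-- The pieces of the graph (vertices and vertex-less circles) directly joined by an edge. -/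
def Adj (G : MultiGraph V E C) (x y : V ⊕ C) : Prop :=
  ∃ e : E, x = Sum.inl (G.vert (e, false)) ∧ y = Sum.inl (G.vert (e, true))

/-- The graph, as a topological space, is nonempty and connected. -/
def IsConnected (G : MultiGraph V E C) : Prop :=
  Nonempty (V ⊕ C) ∧ ∀ x y : V ⊕ C, Relation.EqvGen G.Adj x y

/-- An isomorphism of multigraphs. `rev e` records whether the interval `e` is mapped to the
interval `edge e` with its two ends exchanged. -/
structure Iso (G : MultiGraph V E C) (G' : MultiGraph V' E' C') where
  /-- the bijection of vertices -/
  vertex : V ≃ V'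
  /-- the bijection of edges -/
  edge : E ≃ E'
  /-- the bijection of vertex-less edges -/
  circle : C ≃ C'
  /-- whether the two ends of an edge are exchanged -/
  rev : E → Bool
  vert_edge : ∀ e b, G'.vert (edge e, xor b (rev e)) = vertex (G.vert (e, b))

/-- The effect of an isomorphism on half-edges. -/
def Iso.half {G : MultiGraph V E C} {G' : MultiGraph V' E' C'} (f : G.Iso G')
    (h : E × Bool) : E' × Bool :=
  (f.edge h.1, xor h.2 (f.rev h.1))

end MultiGraph

/-- A ribbon graph of `G`, given by a signed rotation system: a cyclic order of the half-edges
at every vertex (`rot h` is the half-edge that follows `h` counterclockwise at its vertex) and a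
sign for every edge. The surface has a disk for every vertex and a band for every edge, with a
half-twist in the band exactly when the sign is `-1`; a vertex-less edge gives an annulus
(sign `1`) or a Möbius band (sign `-1`). -/
structure RibbonGraph {V E C : Type*} (G : MultiGraph V E C) where
  /-- the cyclic orders at the vertices -/
  rot : Equiv.Perm (E × Bool)
  sameCycle_iff : ∀ h h' : E × Bool, rot.SameCycle h h' ↔ G.vert h = G.vert h'
  /-- the signs of the edges -/
  sign : E ⊕ C → ℤˣ

namespace RibbonGraph

variable {V E C V' E' C' : Type*} {G : MultiGraph V E C} {G' : MultiGraph V' E' C'}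

/-- The surface is orientable: the disks can be oriented (`o v = 1` if the orientation of the disk
of `v` is the one that defines `rot`, and `o v = -1` otherwise) so that the orientations agree
along all bands. -/
def IsOrientable (Γ : RibbonGraph G) : Prop :=
  (∃ o : V → ℤˣ, ∀ e : E,
    Γ.sign (Sum.inl e) = o (G.vert (e, false)) * o (G.vert (e, true))) ∧
  ∀ c : C, Γ.sign (Sum.inr c) = 1

/-- Equivalence of ribbon graphs, i.e. the existence of a homeomorphism of the closed surfaces
that carries one embedded graph onto the other. In terms of signed rotation systems: an
isomorphism of the underlying graphs, and for every vertex the information whether its disk is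
carried over preserving the counterclockwise direction (`o v = 1`) or reversing it
(`o v = -1`). -/
def Equivalent (Γ : RibbonGraph G) (Γ' : RibbonGraph G') : Prop :=
  ∃ (f : G.Iso G') (o : V → ℤˣ),
    (∀ h : E × Bool, o (G.vert h) = 1 → Γ'.rot (f.half h) = f.half (Γ.rot h)) ∧
    (∀ h : E × Bool, o (G.vert h) = -1 → Γ'.rot (f.half (Γ.rot h)) = f.half h) ∧
    (∀ e : E, Γ'.sign (Sum.inl (f.edge e)) =
      o (G.vert (e, false)) * o (G.vert (e, true)) * Γ.sign (Sum.inl e)) ∧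
    ∀ c : C, Γ'.sign (Sum.inr (f.circle c)) = Γ.sign (Sum.inr c)

/-- The ribbon graph obtained by inserting `t e` half-twists into the band of every edge `e`. -/
def twist (Γ : RibbonGraph G) (t : E ⊕ C → ℕ) : RibbonGraph G where
  rot := Γ.rot
  sameCycle_iff := Γ.sameCycle_iff
  sign e := Γ.sign e * (-1) ^ t e

/-- `Γ` is even with respect to `Γ'`: inserting an even number of half-twists into the bands of
`Γ` makes it equivalent to `Γ'`. -/
def IsEvenWrt [Fintype E] [Fintype C] (Γ : RibbonGraph G) (Γ' : RibbonGraph G') : Prop :=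
  ∃ t : E ⊕ C → ℕ, Even (∑ e, t e) ∧ (Γ.twist t).Equivalent Γ'

/-- `Γ` is odd with respect to `Γ'`: inserting an odd number of half-twists into the bands of
`Γ` makes it equivalent to `Γ'`. -/
def IsOddWrt [Fintype E] [Fintype C] (Γ : RibbonGraph G) (Γ' : RibbonGraph G') : Prop :=
  ∃ t : E ⊕ C → ℕ, Odd (∑ e, t e) ∧ (Γ.twist t).Equivalent Γ'

/-- The arcs of the vertex state of `Γ` in which the vertices in `ν` are `1`-smoothed and the
others are `0`-smoothed.

The band of a half-edge `h` has two corners on the boundary of the disk of its vertex; they are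
`(h, false)` and `(h, true)`, in the order in which they are met counterclockwise. The
`0`-smoothing follows the boundary of the disk: it joins the second corner of `h` to the first
corner of the next half-edge. The `1`-smoothing does the same for the reversed cyclic order. The
two sides of a band join the corners at its two ends, crosswise in this labeling unless there is a
half-twist. A vertex-less edge `c` has two sides `(c, false)`, `(c, true)`, which are two circles
in an annulus and form one circle in a Möbius band. -/
inductive StateArc (Γ : RibbonGraph G) (ν : Finset V) :
    ((E × Bool) ⊕ C) × Bool → ((E × Bool) ⊕ C) × Bool → Prop
  | zeroSmoothing (h : E × Bool) : G.vert h ∉ ν →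
      StateArc Γ ν (Sum.inl h, true) (Sum.inl (Γ.rot h), false)
  | oneSmoothing (h : E × Bool) : G.vert h ∈ ν →
      StateArc Γ ν (Sum.inl (Γ.rot h), true) (Sum.inl h, false)
  | band (e : E) (s : Bool) : Γ.sign (Sum.inl e) = 1 →
      StateArc Γ ν (Sum.inl (e, false), s) (Sum.inl (e, true), !s)
  | twistedBand (e : E) (s : Bool) : Γ.sign (Sum.inl e) = -1 →
      StateArc Γ ν (Sum.inl (e, false), s) (Sum.inl (e, true), s)
  | twistedCircle (c : C) : Γ.sign (Sum.inr c) = -1 →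
      StateArc Γ ν (Sum.inr c, false) (Sum.inr c, true)

/-- The number of immersed circles in the vertex state `ν`. -/
noncomputable def numCircles (Γ : RibbonGraph G) (ν : Finset V) : ℕ :=
  Nat.card (Quot (Γ.StateArc ν))

/-- The vertex polynomial: expand every vertex as its `0`-smoothing minus its `1`-smoothing and
replace every circle of every resulting state by the variable. -/
noncomputable def vertexPolynomial [Fintype V] (Γ : RibbonGraph G) : ℤ[X] :=
  ∑ ν : Finset V, (-1) ^ ν.card * X ^ Γ.numCircles ν

end RibbonGraph

/-- `p` is the vertex polynomial of a nonnegative oriented ribbon graph of `G`, where nonnegative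
means that the leading coefficient of its vertex polynomial is nonnegative. -/
def MultiGraph.IsVertexPolynomial {V E C : Type*} [Fintype V] (G : MultiGraph V E C)
    (p : ℤ[X]) : Prop :=
  ∃ Γ : RibbonGraph G, Γ.IsOrientable ∧ 0 ≤ Γ.vertexPolynomial.leadingCoeff ∧
    Γ.vertexPolynomial = p

/-! Turning over the disk of a vertex reverses its cyclic order and puts a half-twist at each of the
three band ends there; the ribbon graph is the same up to equivalence. Reversing the cyclic order
alone instead exchanges the 0- and 1-smoothings at that vertex, which multiplies the polynomial by
-1. `Related` keeps the two effects apart: `r` marks the reversed cyclic orders, `o` the disk turns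
that account for the change of signs. The smoothings are exchanged exactly where `o` and `r`
disagree, so the polynomials differ by the factor `∏ v, o v * r v` (`Related.vertexPolynomial_eq`).

Three half-edges have only two cyclic orders, so an `r` always exists (`exists_rot_related`). The
edge signs of an orientable ribbon graph form a coboundary, so for two of them an `o` exists as
well. This gives equality up to sign.

For the parity, if twisting by `t` gives an equivalence, then `(-1) ^ t` on edges is the coboundary
of a function `p` on vertices, and the factor above is `∏ v, p v`. Every vertex is met by three edge
ends and `p v ^ 3 = p v`, so this is also the product of `(-1) ^ t` (`Trivalent.prod_vert`). -/

namespace MultiGraph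

/-! ### Graph isomorphisms and trivalence -/

variable {V E C V' E' C' : Type*} {G : MultiGraph V E C} {G' : MultiGraph V' E' C'}

/-- The identity isomorphism. -/
def Iso.refl (G : MultiGraph V E C) : G.Iso G where
  vertex := Equiv.refl V
  edge := Equiv.refl E
  circle := Equiv.refl C
  rev _ := false
  vert_edge e b := by simp

/-- The inverse isomorphism. -/
def Iso.symm (f : G.Iso G') : G'.Iso G where
  vertex := f.vertex.symm
  edge := f.edge.symm
  circle := f.circle.symm
  rev e := f.rev (f.edge.symm e)
  vert_edge e b := by
    have h := f.vert_edge (f.edge.symm e) (xor b (f.rev (f.edge.symm e)))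
    simp only [Equiv.apply_symm_apply, Bool.xor_assoc, Bool.xor_self, Bool.xor_false] at h
    rw [h, Equiv.symm_apply_apply]

theorem Iso.refl_half (h : E × Bool) : (Iso.refl G).half h = h := by
  simp [Iso.half, Iso.refl]

theorem Iso.vert_half (f : G.Iso G') (h : E × Bool) :
    G'.vert (f.half h) = f.vertex (G.vert h) := f.vert_edge h.1 h.2

theorem Iso.symm_half_half (f : G.Iso G') (h : E × Bool) : f.symm.half (f.half h) = h := by
  simp [Iso.half, Iso.symm]

theorem Iso.half_symm_half (f : G.Iso G') (h : E' × Bool) : f.half (f.symm.half h) = h := by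
  simp [Iso.half, Iso.symm]

/-- The bijection of half-edges induced by an isomorphism. -/
def Iso.halfEquiv (f : G.Iso G') : E × Bool ≃ E' × Bool where
  toFun := f.half
  invFun := f.symm.half
  left_inv := f.symm_half_half
  right_inv := f.half_symm_half

/-- In a trivalent graph, the half-edges at every vertex can be numbered by `0, 1, 2`. -/
theorem Trivalent.exists_equiv (htri : G.Trivalent) :
    ∃ φ : E × Bool ≃ V × Fin 3, ∀ h, (φ h).1 = G.vert h := by
  have key (v : V) : Nonempty ({h // G.vert h = v} ≃ Fin 3) := by
    have h3 : Nat.card {h // G.vert h = v} = 3 := htri v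
    have : Finite {h // G.vert h = v} := Nat.finite_of_card_ne_zero (by omega)
    exact ⟨Finite.equivFinOfCardEq h3⟩
  let φ := fun v => (key v).some
  exact ⟨(Equiv.sigmaFiberEquiv G.vert).symm.trans
    ((Equiv.sigmaCongrRight φ).trans (Equiv.sigmaEquivProd V (Fin 3))), fun h => rfl⟩

/-- Every vertex occurs three times as an end of an edge, and the cube of a sign is the sign itself.
-/
theorem Trivalent.prod_vert [Fintype V] [Fintype E] (htri : G.Trivalent) (p : V → ℤˣ) :
    ∏ e : E, p (G.vert (e, false)) * p (G.vert (e, true)) = ∏ v, p v := by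
  obtain ⟨φ, hφ⟩ := htri.exists_equiv
  calc ∏ e : E, p (G.vert (e, false)) * p (G.vert (e, true))
      = ∏ h : E × Bool, p (G.vert h) := by
        rw [Fintype.prod_prod_type]
        exact Finset.prod_congr rfl fun e _ => by rw [Fintype.prod_bool, mul_comm]
    _ = ∏ x : V × Fin 3, p x.1 := Fintype.prod_equiv φ _ _ fun h => by rw [hφ]
    _ = ∏ v, p v := by
        rw [Fintype.prod_prod_type]
        refine Finset.prod_congr rfl fun v _ => ?_
        rcases Int.units_eq_one_or (p v) with h | h <;> simp [h] <;> rfl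

end MultiGraph

/-! ### Circles of corresponding states -/

namespace RibbonGraph

open MultiGraph

variable {V E C V' E' C' : Type*} {G : MultiGraph V E C} {G' : MultiGraph V' E' C'}

theorem sameCycle_permCongr {α β : Type*} (e : α ≃ β) (σ : Equiv.Perm α) (x y : α) :
    (e.permCongr σ).SameCycle (e x) (e y) ↔ σ.SameCycle x y := by
  refine exists_congr fun i => ?_
  have h : e.permCongr σ ^ i = e.permCongr (σ ^ i) := (map_zpow e.permCongrHom σ i).symm
  rw [h, Equiv.permCongr_apply, Equiv.symm_apply_apply, e.apply_eq_iff_eq]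

theorem vert_rot (Γ : RibbonGraph G) (h : E × Bool) : G.vert (Γ.rot h) = G.vert h :=
  ((Γ.sameCycle_iff h (Γ.rot h)).1 ⟨1, by simp⟩).symm

/-- An isomorphism of the underlying graphs that carries the cyclic order at a vertex `v` to
itself if `r v = 1` and to its reverse if `r v = -1`, and changes the signs of the edges by the
coboundary of `o`. -/
structure Related (Γ : RibbonGraph G) (Γ' : RibbonGraph G') (f : G.Iso G') (o r : V → ℤˣ) :
    Prop where
  rot_pos : ∀ h, r (G.vert h) = 1 → Γ'.rot (f.half h) = f.half (Γ.rot h)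
  rot_neg : ∀ h, r (G.vert h) = -1 → Γ'.rot (f.half (Γ.rot h)) = f.half h
  sign_edge : ∀ e, Γ'.sign (Sum.inl (f.edge e)) =
    o (G.vert (e, false)) * o (G.vert (e, true)) * Γ.sign (Sum.inl e)
  sign_circle : ∀ c, Γ'.sign (Sum.inr (f.circle c)) = Γ.sign (Sum.inr c)

theorem Related.symm {Γ : RibbonGraph G} {Γ' : RibbonGraph G'} {f : G.Iso G'} {o r : V → ℤˣ}
    (H : Related Γ Γ' f o r) :
    Related Γ' Γ f.symm (fun v => o (f.vertex.symm v)) (fun v => r (f.vertex.symm v)) where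
  rot_pos h hr := by
    obtain ⟨h, rfl⟩ := f.halfEquiv.surjective h
    change r (f.vertex.symm (G'.vert (f.half h))) = 1 at hr
    change Γ.rot (f.symm.half (f.half h)) = f.symm.half (Γ'.rot (f.half h))
    rw [f.vert_half, Equiv.symm_apply_apply] at hr
    rw [H.rot_pos h hr, f.symm_half_half, f.symm_half_half]
  rot_neg h hr := by
    obtain ⟨h, rfl⟩ := f.halfEquiv.surjective h
    obtain ⟨h, rfl⟩ := Γ.rot.surjective h
    change r (f.vertex.symm (G'.vert (f.half _))) = -1 at hr
    change Γ.rot (f.symm.half (Γ'.rot (f.half _))) = f.symm.half (f.half _)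
    rw [f.vert_half, Equiv.symm_apply_apply, Γ.vert_rot] at hr
    rw [H.rot_neg h hr, f.symm_half_half, f.symm_half_half]
  sign_edge e := by
    obtain ⟨e, rfl⟩ := f.edge.surjective e
    have h0 := f.symm.vert_edge (f.edge e) false
    have h1 := f.symm.vert_edge (f.edge e) true
    simp only [Iso.symm, Equiv.symm_apply_apply] at h0 h1 ⊢
    rw [H.sign_edge, ← h0, ← h1]
    cases f.rev e <;>
      rcases Int.units_eq_one_or (o (G.vert (e, false))) with ha | ha <;>
      rcases Int.units_eq_one_or (o (G.vert (e, true))) with hb | hb <;> simp [ha, hb]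
  sign_circle c := by
    obtain ⟨c, rfl⟩ := f.circle.surjective c
    simp [Iso.symm, H.sign_circle]

/-- The map of corners that follows `f` and exchanges the two corners of each half-edge at a
vertex `v` with `o v = -1`. -/
def cornerMap (f : G.Iso G') (o : V → ℤˣ) :
    ((E × Bool) ⊕ C) × Bool → ((E' × Bool) ⊕ C') × Bool
  | (Sum.inl h, b) => (Sum.inl (f.half h), if o (G.vert h) = 1 then b else !b)
  | (Sum.inr c, b) => (Sum.inr (f.circle c), b)

theorem cornerMap_surjective (f : G.Iso G') (o : V → ℤˣ) :
    Function.Surjective (cornerMap f o) := by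
  rintro ⟨h | c, b⟩
  · obtain ⟨h, rfl⟩ := f.halfEquiv.surjective h
    refine ⟨(Sum.inl h, if o (G.vert h) = 1 then b else !b), ?_⟩
    by_cases ho : o (G.vert h) = 1 <;> simp [cornerMap, ho, Iso.halfEquiv]
  · obtain ⟨c, rfl⟩ := f.circle.surjective c
    exact ⟨(Sum.inr c, b), rfl⟩

/-- Exchanging the corners at a vertex carries the arcs of a cyclic order to those of its reverse,
so the effects of `o` and `r` on the smoothing cancel where they agree. Arcs may change direction,
both under this exchange and when an edge is reversed; hence the disjunction. -/
theorem StateArc.map {Γ : RibbonGraph G} {Γ' : RibbonGraph G'} {f : G.Iso G'} {o r : V → ℤˣ}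
    (H : Related Γ Γ' f o r) {ν : Finset V} {ν' : Finset V'}
    (hν : ∀ v, f.vertex v ∈ ν' ↔ (v ∈ ν ↔ o v = r v))
    {x y : ((E × Bool) ⊕ C) × Bool} (h : Γ.StateArc ν x y) :
    Γ'.StateArc ν' (cornerMap f o x) (cornerMap f o y) ∨
      Γ'.StateArc ν' (cornerMap f o y) (cornerMap f o x) := by
  -- The exceptional cases do not involve `r`: its value only decides which smoothing of `Γ'`
  -- supplies the arc.
  have key (h : E × Bool) : Γ'.StateArc ν' (Sum.inl (f.half h), true)
      (Sum.inl (f.half (Γ.rot h)), false) ∨ G.vert h ∈ ν ∧ o (G.vert h) = 1 ∨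
        G.vert h ∉ ν ∧ o (G.vert h) = -1 := by
    have hv := f.vert_half h
    have hw := f.vert_half (Γ.rot h)
    rw [Γ.vert_rot] at hw
    have hm := hν (G.vert h)
    rcases Int.units_eq_one_or (r (G.vert h)) with hr | hr
    · have h0 := StateArc.zeroSmoothing (Γ := Γ') (ν := ν') (f.half h)
      rw [H.rot_pos h hr] at h0
      rcases Int.units_eq_one_or (o (G.vert h)) with ho | ho <;> simp_all <;> tauto
    · have h1 := StateArc.oneSmoothing (Γ := Γ') (ν := ν') (f.half (Γ.rot h))
      rw [H.rot_neg h hr] at h1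
      rcases Int.units_eq_one_or (o (G.vert h)) with ho | ho <;> simp_all <;> tauto
  have key' (h : E × Bool) : Γ'.StateArc ν' (Sum.inl (f.half (Γ.rot h)), true)
      (Sum.inl (f.half h), false) ∨ G.vert h ∉ ν ∧ o (G.vert h) = 1 ∨
        G.vert h ∈ ν ∧ o (G.vert h) = -1 := by
    have hv := f.vert_half h
    have hw := f.vert_half (Γ.rot h)
    rw [Γ.vert_rot] at hw
    have hm := hν (G.vert h)
    rcases Int.units_eq_one_or (r (G.vert h)) with hr | hr
    · have h1 := StateArc.oneSmoothing (Γ := Γ') (ν := ν') (f.half h)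
      rw [H.rot_pos h hr] at h1
      rcases Int.units_eq_one_or (o (G.vert h)) with ho | ho <;> simp_all <;> tauto
    · have h0 := StateArc.zeroSmoothing (Γ := Γ') (ν := ν') (f.half (Γ.rot h))
      rw [H.rot_neg h hr] at h0
      rcases Int.units_eq_one_or (o (G.vert h)) with ho | ho <;> simp_all <;> tauto
  have band' (e : E) (s : Bool) := StateArc.band (Γ := Γ') (ν := ν') (f.edge e) s
  have twistedBand' (e : E) (s : Bool) := StateArc.twistedBand (Γ := Γ') (ν := ν') (f.edge e) s
  cases h with
  | zeroSmoothing h hh =>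
    have h1 := key h
    have h2 := key' h
    rcases Int.units_eq_one_or (o (G.vert h)) with ho | ho <;>
      simp_all [cornerMap, Γ.vert_rot]
  | oneSmoothing h hh =>
    have h1 := key h
    have h2 := key' h
    rcases Int.units_eq_one_or (o (G.vert h)) with ho | ho <;>
      simp_all [cornerMap, Γ.vert_rot]
  | band e s hs =>
    have h0 := band' e
    have h1 := twistedBand' e
    rw [H.sign_edge, hs] at h0 h1
    rcases Int.units_eq_one_or (o (G.vert (e, false))) with ha | ha <;>
      rcases Int.units_eq_one_or (o (G.vert (e, true))) with hb | hb <;>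
      cases hrev : f.rev e <;> cases s <;> simp_all [cornerMap, Iso.half]
  | twistedBand e s hs =>
    have h0 := band' e
    have h1 := twistedBand' e
    rw [H.sign_edge, hs] at h0 h1
    rcases Int.units_eq_one_or (o (G.vert (e, false))) with ha | ha <;>
      rcases Int.units_eq_one_or (o (G.vert (e, true))) with hb | hb <;>
      cases hrev : f.rev e <;> cases s <;> simp_all [cornerMap, Iso.half]
  | twistedCircle c hc => exact Or.inl (.twistedCircle _ (by rw [H.sign_circle, hc]))

/-- The corner map induces a surjection on circles; the reverse inequality will come from
`Related.symm`, so injectivity is never checked. -/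
theorem Related.numCircles_le [Fintype E] [Fintype C] {Γ : RibbonGraph G} {Γ' : RibbonGraph G'}
    {f : G.Iso G'} {o r : V → ℤˣ} (H : Related Γ Γ' f o r) {ν : Finset V} {ν' : Finset V'}
    (hν : ∀ v, f.vertex v ∈ ν' ↔ (v ∈ ν ↔ o v = r v)) :
    Γ'.numCircles ν' ≤ Γ.numCircles ν := by
  refine Nat.card_le_card_of_surjective
    (Quot.lift (fun x => Quot.mk (Γ'.StateArc ν') (cornerMap f o x)) ?_) ?_
  · intro x y hxy
    exact (hxy.map H hν).elim (fun h => Quot.sound h) fun h => (Quot.sound h).symm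
  · intro q
    obtain ⟨y, rfl⟩ := Quot.exists_rep q
    obtain ⟨x, rfl⟩ := cornerMap_surjective f o y
    exact ⟨Quot.mk _ x, rfl⟩

theorem Related.numCircles_eq [Fintype E] [Fintype C] [Fintype E'] [Fintype C']
    {Γ : RibbonGraph G} {Γ' : RibbonGraph G'}
    {f : G.Iso G'} {o r : V → ℤˣ} (H : Related Γ Γ' f o r) {ν : Finset V} {ν' : Finset V'}
    (hν : ∀ v, f.vertex v ∈ ν' ↔ (v ∈ ν ↔ o v = r v)) :
    Γ'.numCircles ν' = Γ.numCircles ν := by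
  refine le_antisymm (H.numCircles_le hν) (H.symm.numCircles_le fun v => ?_)
  obtain ⟨v, rfl⟩ := f.vertex.surjective v
  have := hν v
  simp only [Iso.symm, Equiv.symm_apply_apply]
  tauto

/-! ### Corresponding states and their signs -/

open Classical in
/-- The correspondence of states given by an isomorphism that exchanges the two smoothings at the
vertices `v` with `o v ≠ r v`. -/
noncomputable def stateEquiv [Fintype V] [Fintype V'] (f : G.Iso G') (o r : V → ℤˣ) :
    Finset V ≃ Finset V' where
  toFun ν := {v | f.vertex.symm v ∈ ν ↔ o (f.vertex.symm v) = r (f.vertex.symm v)}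
  invFun ν' := {v | f.vertex v ∈ ν' ↔ o v = r v}
  left_inv ν := by
    ext v
    simp only [Finset.mem_filter, Finset.mem_univ, true_and, Equiv.symm_apply_apply]
    tauto
  right_inv ν' := by
    ext v
    simp only [Finset.mem_filter, Finset.mem_univ, true_and, Equiv.apply_symm_apply]
    tauto

theorem mem_stateEquiv [Fintype V] [Fintype V'] (f : G.Iso G') (o r : V → ℤˣ) (ν : Finset V)
    (v : V) : f.vertex v ∈ stateEquiv f o r ν ↔ (v ∈ ν ↔ o v = r v) := by
  simp [stateEquiv]

open Classical in
theorem neg_one_pow_card_eq_prod [Fintype V] (ν : Finset V) :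
    (-1 : ℤˣ) ^ ν.card = ∏ v, if v ∈ ν then -1 else 1 := by
  rw [Finset.prod_ite_mem, Finset.univ_inter, Finset.prod_const]

theorem neg_one_pow_card_stateEquiv [Fintype V] [Fintype V'] (f : G.Iso G') (o r : V → ℤˣ)
    (ν : Finset V) :
    (-1 : ℤˣ) ^ (stateEquiv f o r ν).card = (∏ v, o v * r v) * (-1) ^ ν.card := by
  classical
  rw [neg_one_pow_card_eq_prod, neg_one_pow_card_eq_prod, ← Finset.prod_mul_distrib,
    ← Fintype.prod_equiv f.vertex _ _ fun v => rfl]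
  refine Finset.prod_congr rfl fun v _ => ?_
  rw [if_congr (mem_stateEquiv f o r ν v) rfl rfl]
  rcases Int.units_eq_one_or (o v) with ho | ho <;>
    rcases Int.units_eq_one_or (r v) with hr | hr <;>
    by_cases hv : v ∈ ν <;> simp [ho, hr, hv]

theorem Related.vertexPolynomial_eq [Fintype V] [Fintype E] [Fintype C]
    [Fintype V'] [Fintype E'] [Fintype C'] {Γ : RibbonGraph G} {Γ' : RibbonGraph G'}
    {f : G.Iso G'} {o r : V → ℤˣ} (H : Related Γ Γ' f o r) :
    Γ'.vertexPolynomial = (∏ v, o v * r v : ℤˣ) • Γ.vertexPolynomial := by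
  rw [vertexPolynomial, vertexPolynomial, Finset.smul_sum,
    ← Fintype.sum_equiv (stateEquiv f o r) _ _ fun ν => rfl]
  refine Finset.sum_congr rfl fun ν _ => ?_
  rw [H.numCircles_eq (mem_stateEquiv f o r ν)]
  have h := congrArg (fun u : ℤˣ => ((u : ℤ) : ℤ[X])) (neg_one_pow_card_stateEquiv f o r ν)
  push_cast at h
  rw [h, Units.smul_def, zsmul_eq_mul, mul_assoc]
  push_cast
  rfl

/-! ### Cyclic orders at trivalent vertices -/

theorem rot_of_trivalent (htri : G.Trivalent) (Γ : RibbonGraph G) (h : E × Bool) :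
    Γ.rot h ≠ h ∧ Γ.rot (Γ.rot h) ≠ h ∧ Γ.rot (Γ.rot (Γ.rot h)) = h ∧
      ∀ h', G.vert h' = G.vert h → h' = h ∨ h' = Γ.rot h ∨ h' = Γ.rot (Γ.rot h) := by
  have : Finite {h' | G.vert h' = G.vert h} := Set.finite_of_ncard_ne_zero (by rw [htri]; decide)
  let S : Finset (E × Bool) := (Set.toFinite {h' | G.vert h' = G.vert h}).toFinset
  have hmem (h' : E × Bool) : h' ∈ S ↔ G.vert h' = G.vert h := by simp [S]
  have hcard : S.card = 3 := by
    rw [← htri (G.vert h), Set.ncard_eq_toFinset_card _ (Set.toFinite _)]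
  have hS : Γ.rot.IsCycleOn (S : Set (E × Bool)) := by
    refine ⟨Γ.rot.bijOn fun h' => ?_, fun a ha b hb => ?_⟩
    · rw [Finset.mem_coe, Finset.mem_coe, hmem, hmem, Γ.vert_rot]
    · rw [Finset.mem_coe, hmem] at ha hb
      rw [Γ.sameCycle_iff, ha, hb]
  have hh : h ∈ S := (hmem h).2 rfl
  refine ⟨fun H => ?_, fun H => ?_, ?_, fun h' hh' => ?_⟩
  · have := (hS.pow_apply_eq hh (n := 1)).1 H
    rw [hcard] at this
    omega
  · have := (hS.pow_apply_eq hh (n := 2)).1 H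
    rw [hcard] at this
    omega
  · exact (hS.pow_apply_eq hh (n := 3)).2 (by rw [hcard])
  · obtain ⟨n, hn, rfl⟩ := hS.exists_pow_eq hh ((hmem h').2 hh')
    rw [hcard] at hn
    interval_cases n
    · exact Or.inl rfl
    · exact Or.inr (Or.inl rfl)
    · exact Or.inr (Or.inr rfl)

theorem exists_rot_related (htri : G.Trivalent) (Γ Γ' : RibbonGraph G) :
    ∃ r : V → ℤˣ, (∀ h, r (G.vert h) = 1 → Γ'.rot h = Γ.rot h) ∧
      ∀ h, r (G.vert h) = -1 → Γ'.rot (Γ.rot h) = h := by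
  classical
  refine ⟨fun v => if ∀ h, G.vert h = v → Γ'.rot h = Γ.rot h then 1 else -1, ?_, ?_⟩
  · intro h hr
    by_contra hne
    beta_reduce at hr
    rw [if_neg (fun H => hne (H h rfl))] at hr
    exact absurd hr (by decide)
  · intro h hr
    have hex : ¬ ∀ h', G.vert h' = G.vert h → Γ'.rot h' = Γ.rot h' := fun H => by
      beta_reduce at hr
      rw [if_pos H] at hr
      exact absurd hr (by decide)
    -- If `Γ'.rot` does not send `Γ.rot h` back to `h`, it must send it to `Γ.rot (Γ.rot h)`, and
    -- this forces the two 3-cycles to agree.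
    by_contra hne
    apply hex
    obtain ⟨h1, h2, h3, h4⟩ := rot_of_trivalent htri Γ h
    obtain ⟨a1, a2, a3, -⟩ := rot_of_trivalent htri Γ' h
    obtain ⟨b1, b2, b3, -⟩ := rot_of_trivalent htri Γ' (Γ.rot h)
    obtain ⟨c1, c2, c3, -⟩ := rot_of_trivalent htri Γ' (Γ.rot (Γ.rot h))
    have ha := h4 (Γ'.rot h) (Γ'.vert_rot h)
    have hb := h4 (Γ'.rot (Γ.rot h)) (by rw [Γ'.vert_rot, Γ.vert_rot])
    have hc := h4 (Γ'.rot (Γ.rot (Γ.rot h))) (by rw [Γ'.vert_rot, Γ.vert_rot, Γ.vert_rot])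
    intro h' hh'
    rcases h4 h' hh' with rfl | rfl | rfl <;> grind

/-- The permutation of `V × Fin 3` that adds `1` to the second component over `v` if `r v = 1`
and subtracts `1` if `r v = -1`. -/
def shiftPerm (r : V → ℤˣ) : Equiv.Perm (V × Fin 3) :=
  Equiv.prodShear (Equiv.refl V) fun v => Equiv.addRight (if r v = 1 then 1 else 2)

theorem sameCycle_shiftPerm_iff (r : V → ℤˣ) (x y : V × Fin 3) :
    (shiftPerm r).SameCycle x y ↔ x.1 = y.1 := by
  constructor
  · rintro ⟨i, rfl⟩
    induction i with
    | zero => rfl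
    | succ i ih =>
      rw [add_comm, zpow_add, zpow_one, Equiv.Perm.mul_apply]
      exact ih
    | pred i ih =>
      rw [ih, sub_eq_add_neg, add_comm, zpow_add, zpow_neg_one, Equiv.Perm.mul_apply]
      rfl
  · obtain ⟨v, i⟩ := x
    obtain ⟨w, j⟩ := y
    rintro rfl
    have key : ∀ u i j : Fin 3, u ≠ 0 → j = i ∨ j = i + u ∨ j = i + u + u := by decide
    have hu : (if r v = 1 then 1 else 2 : Fin 3) ≠ 0 := by split_ifs <;> decide
    rcases key _ i j hu with rfl | rfl | rfl
    · exact ⟨0, rfl⟩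
    · exact ⟨1, rfl⟩
    · exact ⟨2, rfl⟩

/-- The ribbon graph with trivial signs whose cyclic order at `v` is that of the numbers
`0, 1, 2` if `r v = 1` and its reverse if `r v = -1`. -/
def ofNumbering (φ : E × Bool ≃ V × Fin 3) (hφ : ∀ h, (φ h).1 = G.vert h) (r : V → ℤˣ) :
    RibbonGraph G where
  rot := φ.symm.permCongr (shiftPerm r)
  sameCycle_iff h h' := by
    rw [← φ.symm_apply_apply h, ← φ.symm_apply_apply h', sameCycle_permCongr,
      sameCycle_shiftPerm_iff, φ.symm_apply_apply, φ.symm_apply_apply, hφ, hφ]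
  sign _ := 1

theorem ofNumbering_isOrientable (φ : E × Bool ≃ V × Fin 3) (hφ : ∀ h, (φ h).1 = G.vert h)
    (r : V → ℤˣ) : (ofNumbering φ hφ r).IsOrientable :=
  ⟨⟨fun _ => 1, fun _ => rfl⟩, fun _ => rfl⟩

theorem related_ofNumbering (φ : E × Bool ≃ V × Fin 3) (hφ : ∀ h, (φ h).1 = G.vert h)
    (r : V → ℤˣ) :
    Related (ofNumbering φ hφ fun _ => 1) (ofNumbering φ hφ r) (Iso.refl G) (fun _ => 1) r where
  rot_pos h hr := by
    simp only [Iso.refl_half, ofNumbering, shiftPerm, Equiv.permCongr_apply, Equiv.symm_symm,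
      Equiv.prodShear_apply, hφ, hr]
  rot_neg h hr := by
    simp only [Iso.refl_half, ofNumbering, shiftPerm, Equiv.permCongr_apply, Equiv.symm_symm,
      Equiv.prodShear_apply, hφ,
      Equiv.apply_symm_apply, Equiv.refl_apply, hr, Equiv.coe_addRight]
    rw [Equiv.symm_apply_eq]
    refine Prod.ext (hφ h).symm ?_
    change (φ h).2 + 1 + 2 = (φ h).2
    generalize (φ h).2 = i
    revert i
    decide
  sign_edge e := by simp [ofNumbering]
  sign_circle c := by simp [ofNumbering]

/-! ### Oriented ribbon graphs and parity -/

theorem Related.of_isOrientable {Γ Γ' : RibbonGraph G} (hΓ : Γ.IsOrientable)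
    (hΓ' : Γ'.IsOrientable) {r : V → ℤˣ}
    (hpos : ∀ h, r (G.vert h) = 1 → Γ'.rot h = Γ.rot h)
    (hneg : ∀ h, r (G.vert h) = -1 → Γ'.rot (Γ.rot h) = h) :
    ∃ o, Related Γ Γ' (Iso.refl G) o r := by
  obtain ⟨⟨o, ho⟩, hc⟩ := hΓ
  obtain ⟨⟨o', ho'⟩, hc'⟩ := hΓ'
  -- The quotient of two coboundaries is the coboundary of the quotient, and signs are their own
  -- inverses.
  refine ⟨fun v => o v * o' v, ⟨fun h hr => ?_, fun h hr => ?_, fun e => ?_, fun c => ?_⟩⟩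
  · simpa only [Iso.refl_half] using hpos h hr
  · simpa only [Iso.refl_half] using hneg h hr
  · change Γ'.sign (Sum.inl e) = _
    rw [ho, ho']
    generalize o (G.vert (e, false)) = a, o (G.vert (e, true)) = b
    calc _ = (a * a) * (b * b) * (o' (G.vert (e, false)) * o' (G.vert (e, true))) := by
          rw [Int.units_mul_self, Int.units_mul_self, one_mul, one_mul]
      _ = _ := by
          ac_rfl
  · exact (hc' c).trans (hc c).symm

theorem vertexPolynomial_eq_or_eq_neg [Fintype V] [Fintype E] [Fintype C] (htri : G.Trivalent)
    {Γ Γ' : RibbonGraph G} (hΓ : Γ.IsOrientable) (hΓ' : Γ'.IsOrientable) :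
    Γ.vertexPolynomial = Γ'.vertexPolynomial ∨ Γ.vertexPolynomial = -Γ'.vertexPolynomial := by
  obtain ⟨r, hpos, hneg⟩ := exists_rot_related htri Γ' Γ
  obtain ⟨o, H⟩ := Related.of_isOrientable hΓ' hΓ hpos hneg
  rw [H.vertexPolynomial_eq]
  rcases Int.units_eq_one_or (∏ v, o v * r v) with h | h
  · left; rw [h, one_smul]
  · right; rw [h, Units.neg_smul, one_smul]

theorem isEvenWrt_or_isOddWrt [Fintype E] [Fintype C] (htri : G.Trivalent)
    {Γ Γ' : RibbonGraph G} (hΓ : Γ.IsOrientable) (hΓ' : Γ'.IsOrientable) :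
    Γ.IsEvenWrt Γ' ∨ Γ.IsOddWrt Γ' := by
  obtain ⟨r, hpos, hneg⟩ := exists_rot_related htri Γ Γ'
  -- Turning over the disks with `r v = -1` matches the cyclic orders; the bands whose signs then
  -- still disagree get one half-twist each. Circles need none, since both signs are 1.
  let t : E ⊕ C → ℕ := Sum.elim
    (fun e => if Γ'.sign (Sum.inl e) =
      r (G.vert (e, false)) * r (G.vert (e, true)) * Γ.sign (Sum.inl e) then 0 else 1)
    fun _ => 0
  have heq : (Γ.twist t).Equivalent Γ' := by
    refine ⟨Iso.refl G, r, fun h hr => ?_, fun h hr => ?_, fun e => ?_, fun c => ?_⟩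
    · simpa only [Iso.refl_half] using! hpos h hr
    · simpa only [Iso.refl_half] using! hneg h hr
    · change Γ'.sign (Sum.inl e) = _ * (Γ.sign (Sum.inl e) * (-1) ^ (ite _ _ _))
      split_ifs with h
      · rw [h, pow_zero, mul_one]
      · rw [pow_one, mul_neg_one, mul_neg]
        exact Int.units_ne_iff_eq_neg.1 h
    · change Γ'.sign (Sum.inr c) = Γ.sign (Sum.inr c) * (-1) ^ 0
      rw [pow_zero, mul_one, hΓ.2, hΓ'.2]
  exact (Nat.even_or_odd (∑ e, t e)).imp (fun h => ⟨t, h, heq⟩) fun h => ⟨t, h, heq⟩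

theorem vertexPolynomial_of_twist_equivalent [Fintype V] [Fintype E] [Fintype C]
    (htri : G.Trivalent) {Γ Γ' : RibbonGraph G} (hΓ : Γ.IsOrientable) (hΓ' : Γ'.IsOrientable)
    {t : E ⊕ C → ℕ} (heq : (Γ.twist t).Equivalent Γ') :
    Γ'.vertexPolynomial = ((-1) ^ ∑ e, t e : ℤˣ) • Γ.vertexPolynomial := by
  obtain ⟨⟨o₁, ho₁⟩, hc₁⟩ := hΓ
  obtain ⟨⟨o₂, ho₂⟩, hc₂⟩ := hΓ'
  obtain ⟨f, o, hpos, hneg, hedge, hcirc⟩ := heq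
  -- The factors come from the equivalence, the signs of `Γ` and the signs of `Γ'`.
  let p : V → ℤˣ := fun v => o v * o₁ v * o₂ (f.vertex v)
  have hp (e : E) : (-1 : ℤˣ) ^ t (Sum.inl e) = p (G.vert (e, false)) * p (G.vert (e, true)) := by
    have h := hedge e
    have h0 := f.vert_edge e false
    have h1 := f.vert_edge e true
    have hs : Γ'.sign (Sum.inl (f.edge e)) =
        o₂ (f.vertex (G.vert (e, false))) * o₂ (f.vertex (G.vert (e, true))) := by
      rw [ho₂, ← h0, ← h1]
      cases f.rev e
      · rfl
      · exact mul_comm _ _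
    change _ = _ * (Γ.sign (Sum.inl e) * _) at h
    rw [hs, ho₁] at h
    simp only [p]
    generalize (-1 : ℤˣ) ^ t (Sum.inl e) = x at h ⊢
    generalize o₂ (f.vertex (G.vert (e, false))) = a, o₂ (f.vertex (G.vert (e, true))) = b,
      o (G.vert (e, false)) = c, o (G.vert (e, true)) = d,
      o₁ (G.vert (e, false)) = c', o₁ (G.vert (e, true)) = d' at h ⊢
    have h' : x = (c * d) * (c' * d') * (c * d * (c' * d' * x)) := by
      calc x = (c * c) * (d * d) * (c' * c') * (d' * d') * x := by
            simp only [Int.units_mul_self, one_mul]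
        _ = _ := by ac_rfl
    rw [h', ← h]
    ac_rfl
  have hpc (c : C) : (-1 : ℤˣ) ^ t (Sum.inr c) = 1 := by
    have h := hcirc c
    change _ = Γ.sign (Sum.inr c) * _ at h
    rwa [hc₂, hc₁, one_mul, eq_comm] at h
  -- The twists are absorbed into the coboundary, while the cyclic orders are still compared by `o`;
  -- the discrepancy is `p`.
  have H : Related Γ Γ' f (fun v => o v * p v) o := by
    refine ⟨hpos, hneg, fun e => ?_, fun c => ?_⟩
    · rw [hedge]
      change _ * (Γ.sign (Sum.inl e) * _) = _
      rw [hp]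
      ac_rfl
    · rw [hc₂, hc₁]
  rw [H.vertexPolynomial_eq]
  congr 1
  rw [← Finset.prod_pow_eq_pow_sum, Fintype.prod_sum_type]
  simp only [hp, hpc, Finset.prod_const_one, mul_one]
  rw [htri.prod_vert]
  refine Finset.prod_congr rfl fun v _ => ?_
  rw [mul_right_comm, Int.units_mul_self, one_mul]

/-! ### Transport along graph isomorphisms -/

/-- The ribbon graph of `G'` obtained by transporting a ribbon graph along an isomorphism. -/
def map (Γ : RibbonGraph G) (f : G.Iso G') : RibbonGraph G' where
  rot := f.halfEquiv.permCongr Γ.rot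
  sameCycle_iff h h' := by
    obtain ⟨h, rfl⟩ := f.halfEquiv.surjective h
    obtain ⟨h', rfl⟩ := f.halfEquiv.surjective h'
    change _ ↔ G'.vert (f.half h) = G'.vert (f.half h')
    rw [f.vert_half, f.vert_half, f.vertex.apply_eq_iff_eq, ← Γ.sameCycle_iff,
      sameCycle_permCongr]
  sign := Sum.elim (fun e => Γ.sign (Sum.inl (f.edge.symm e)))
    fun c => Γ.sign (Sum.inr (f.circle.symm c))

theorem related_map (Γ : RibbonGraph G) (f : G.Iso G') :
    Related Γ (Γ.map f) f (fun _ => 1) fun _ => 1 where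
  rot_pos h _ := by
    change f.half (Γ.rot (f.symm.half (f.half h))) = _
    rw [f.symm_half_half]
  rot_neg h hr := absurd hr (by decide)
  sign_edge e := by simp [map]
  sign_circle c := by simp [map]

theorem IsOrientable.map {Γ : RibbonGraph G} (hΓ : Γ.IsOrientable) (f : G.Iso G') :
    (Γ.map f).IsOrientable := by
  obtain ⟨⟨o, ho⟩, hc⟩ := hΓ
  refine ⟨⟨fun v => o (f.vertex.symm v), fun e => ?_⟩, fun c => hc _⟩
  obtain ⟨e, rfl⟩ := f.edge.surjective e
  have h0 := f.symm.vert_edge (f.edge e) false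
  have h1 := f.symm.vert_edge (f.edge e) true
  simp only [Iso.symm, Equiv.symm_apply_apply] at h0 h1
  change Γ.sign (Sum.inl (f.edge.symm (f.edge e))) = _
  rw [Equiv.symm_apply_apply, ho]
  beta_reduce
  rw [← h0, ← h1]
  cases f.rev e
  · rfl
  · exact mul_comm _ _

end RibbonGraph

/-! ### The normalized polynomial as a graph invariant -/

namespace MultiGraph

open RibbonGraph

variable {V E C V' E' C' : Type*} [Fintype V] [Fintype E] [Fintype C]
  [Fintype V'] [Fintype E'] [Fintype C'] {G : MultiGraph V E C} {G' : MultiGraph V' E' C'}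

theorem IsVertexPolynomial.of_iso {p : ℤ[X]} (h : G.IsVertexPolynomial p) (f : G.Iso G') :
    G'.IsVertexPolynomial p := by
  obtain ⟨Γ, hΓ, hlc, rfl⟩ := h
  have heq : (Γ.map f).vertexPolynomial = Γ.vertexPolynomial := by
    rw [(Γ.related_map f).vertexPolynomial_eq]
    simp
  exact ⟨Γ.map f, hΓ.map f, heq ▸ hlc, heq⟩

theorem Trivalent.exists_isVertexPolynomial (htri : G.Trivalent) :
    ∃ p, G.IsVertexPolynomial p := by
  classical
  obtain ⟨φ, hφ⟩ := htri.exists_equiv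
  by_cases hlc : 0 ≤ (ofNumbering φ hφ fun _ => 1).vertexPolynomial.leadingCoeff
  · exact ⟨_, _, ofNumbering_isOrientable φ hφ _, hlc, rfl⟩
  rcases isEmpty_or_nonempty V with hV | ⟨⟨v₀⟩⟩
  -- Without vertices there is only one state, so the polynomial is a power of `X`.
  · refine absurd ?_ hlc
    rw [vertexPolynomial, Fintype.sum_unique]
    simp [Finset.eq_empty_of_isEmpty]
  -- Reversing the cyclic order at the single vertex `v₀` negates the polynomial.
  · refine ⟨_, _, ofNumbering_isOrientable φ hφ fun v => if v = v₀ then -1 else 1, ?_, rfl⟩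
    rw [(related_ofNumbering φ hφ _).vertexPolynomial_eq]
    simp only [one_mul, Finset.prod_ite_eq', Finset.mem_univ, if_true, Units.neg_smul, one_smul,
      leadingCoeff_neg]
    omega

theorem Trivalent.isVertexPolynomial_unique (htri : G.Trivalent) {p q : ℤ[X]}
    (hp : G.IsVertexPolynomial p) (hq : G.IsVertexPolynomial q) : p = q := by
  obtain ⟨Γ, hΓ, hlc, rfl⟩ := hp
  obtain ⟨Γ', hΓ', hlc', rfl⟩ := hq
  rcases vertexPolynomial_eq_or_eq_neg htri hΓ hΓ' with h | h
  · exact h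
  -- Opposite leading coefficients that are both nonnegative vanish, so both polynomials are zero.
  · rw [h, leadingCoeff_neg] at hlc
    have h0 : Γ'.vertexPolynomial = 0 := leadingCoeff_eq_zero.1 (by omega)
    rw [h, h0, neg_zero]

end MultiGraph

theorem mainTheorem12 {V E C : Type*} [Fintype V] [Fintype E] [Fintype C]
    (G : MultiGraph V E C) (hconn : G.IsConnected) (htri : G.Trivalent) :
    -- the vertex polynomials of two oriented ribbon graphs of `G` agree up to a sign,
    -- which is determined by the parity of the one with respect to the other
    (∀ Γ₁ Γ₂ : RibbonGraph G, Γ₁.IsOrientable → Γ₂.IsOrientable →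
      (Γ₁.vertexPolynomial = Γ₂.vertexPolynomial ∨
        Γ₁.vertexPolynomial = -Γ₂.vertexPolynomial) ∧
      (Γ₁.IsEvenWrt Γ₂ ∨ Γ₁.IsOddWrt Γ₂) ∧
      (Γ₁.IsEvenWrt Γ₂ → Γ₁.vertexPolynomial = Γ₂.vertexPolynomial) ∧
      (Γ₁.IsOddWrt Γ₂ → Γ₁.vertexPolynomial = -Γ₂.vertexPolynomial)) ∧
    -- hence the nonnegative oriented ribbon graphs of `G` define a polynomial of the abstract
    -- graph `G`, which is the same for isomorphic graphs
    (∃! p : ℤ[X], G.IsVertexPolynomial p) ∧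
    (∀ (V' E' C' : Type*) [Fintype V'] [Fintype E'] [Fintype C'] (G' : MultiGraph V' E' C'),
      Nonempty (G.Iso G') →
        ∀ p : ℤ[X], G.IsVertexPolynomial p ↔ G'.IsVertexPolynomial p) := by
  refine ⟨fun Γ₁ Γ₂ h₁ h₂ => ⟨RibbonGraph.vertexPolynomial_eq_or_eq_neg htri h₁ h₂,
    RibbonGraph.isEvenWrt_or_isOddWrt htri h₁ h₂, ?_, ?_⟩, ?_, ?_⟩
  · rintro ⟨t, ht, heq⟩
    rw [RibbonGraph.vertexPolynomial_of_twist_equivalent htri h₁ h₂ heq, ht.neg_one_pow, one_smul]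
  · rintro ⟨t, ht, heq⟩
    rw [RibbonGraph.vertexPolynomial_of_twist_equivalent htri h₁ h₂ heq, ht.neg_one_pow,
      Units.neg_smul, one_smul, neg_neg]
  · obtain ⟨p, hp⟩ := htri.exists_isVertexPolynomial
    exact ⟨p, hp, fun q hq => htri.isVertexPolynomial_unique hq hp⟩
  · rintro V' E' C' _ _ _ G' ⟨f⟩ p
    exact ⟨fun h => h.of_iso f, fun h => h.of_iso f.symm⟩
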